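/- **Setting.** A (general) logic program $P$ is a finite list of clauses $A\leftarrow L_1,\dots,L_n$, where $A$ is an atom and each $L_i$ is a literal (an atom or a negated atom) over first-order terms with infinitely many variables. A goal is $\leftarrow L_1,\dots,L_n$; its selected subgoal is the left-most literal $L_1$. A *generalized SLDNF-tree* for $P$ and a top goal $G_0$ is a tree whose nodes carry goals in which every subgoal has a set of ancestors (selected subgoals at earlier nodes). The root carries $G_0$, without ancestors. Let $N:\ \leftarrow L_1,\dots,L_n$ be a node. * If $n=0$, then $N$ is a success leaf. * If $L_1$ is an atom, then $N$ has one child for each clause $C$ of $P$ (in textual order) such that $L_1$ is unifiable with the head of a variant $B\leftarrow B_1,\dots,B_m$ of $C$ without variables in common with the goal. The child carries $\leftarrow (B_1,\dots,B_m,L_2,\dots,L_n)\theta$, where $\theta$ is an mgu of $L_1$ and $B$ (any mgu may be used; in particular the mgus that treat some variables of $G_0$ as input-mode variables, so moded generalized SLDNF-trees are included). Each $B_i\theta$ has as ancestors $L_1$ at $N$ and all ancestors of $L_1$; each $L_i\theta$ with $i\ge 2$ keeps its ancestors. If there is no such clause, $N$ is a failure leaf. * If $L_1=\neg A$ with $A$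 ground, then a negation arc leads from $N$ to the root $\leftarrow A$ of a subsidiary SLDNF-tree, where $A$ inherits the ancestors of $\neg A$. If the subsidiary tree has a success leaf, $N$ is a failure leaf; if the subsidiary tree finitely fails, $N$ has in addition the child $\leftarrow L_2,\dots,L_n$; otherwise $N$ has no further child. * If $L_1=\neg A$ with $A$ not ground, then $N$ has no child. Each subsidiary SLDNF-tree stops at its first success leaf in depth-first, left-to-right order: nodes that come after a success leaf of the same subsidiary tree are not expanded. A *generalized SLDNF-derivation* is a finite or infinite path $N_0:G_0,\ N_1:G_1,\dots$ in such a tree (along clause edges, negation arcs, and the edges that drop a negated atom) starting at the root. The *symbol string* of an atom is the sequence of its predicate symbol, function symbols, constants and variables read from left to right, with every variable replaced by one letter $\mathcal X$. An atom $A_1$ *loops into* an atom $A_2$ if they have the same predicate symbol and the symbol string of $A_1$ is obtained from that of $A_2$ by removing zero or more letters. For nodes $N_i,N_j$ of a derivation, $G_j$ is a *loop goal* of $G_i$ if the selected subgoals $L_i^1$, $L_j^1$ are atoms, $L_i^1$ (at $N_i$) is an ancestor of $L_j^1$, and $L_i^1$ loops into $L_j^1$. For a repetition number $r\ge 2$,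 *LP-check* cuts a derivation at a node $N_{g_r}$ (that is, removes all later nodes) if the derivation has nodes $N_{g_1},\dots,N_{g_r}$ with $g_1<\dots<g_r$ and there is one clause $C$ of $P$ such that (a) $G_{g_{j+1}}$ is a loop goal of $G_{g_j}$ for all $1\le j<r$, and (b) the derivation applies $C$ to $G_{g_j}$ for all $1\le j\le r$. **Theorem.** For every repetition number $r\ge 2$, LP-check is a complete loop check: for every logic program $P$, every top goal $G_0$ and every generalized SLDNF-tree for $P$ and $G_0$, LP-check cuts every infinite generalized SLDNF-derivation in that tree at some node. -/

import Mathlib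

universe u v w

namespace LogicProg

/-! ### Syntax of general logic programs

Function symbols (constants are the nullary ones) and predicate symbols are those of a first-order
language `L`; variables are the elements of `V`. -/

/-- An atom `p(T₁, …, Tₙ)`. -/
structure Atom (L : FirstOrder.Language.{u, v}) (V : Type w) where
  arity : ℕ
  pred : L.Relations arity
  args : Fin arity → L.Term V

/-- A literal is an atom or the negation of an atom. -/
inductive Literal (L : FirstOrder.Language.{u, v}) (V : Type w) where
  | pos (A : Atom L V)
  | neg (A : Atom L V)

/-- A clause `head ← body`. -/
structure Clause (L : FirstOrder.Language.{u, v}) (V : Type w) where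
  head : Atom L V
  body : List (Literal L V)

/-- A program: finitely many clauses, listed in their textual order. -/
abbrev Program (L : FirstOrder.Language.{u, v}) (V : Type w) := List (Clause L V)

/-- A goal `← L₁, …, Lₙ`. -/
abbrev Goal (L : FirstOrder.Language.{u, v}) (V : Type w) := List (Literal L V)

/-- A substitution. -/
abbrev Subst (L : FirstOrder.Language.{u, v}) (V : Type w) := V → L.Term V

def termVars {L : FirstOrder.Language.{u, v}} {V : Type w}
    : L.Term V → Set V
  | .var x => {x}
  | .func _ ts => ⋃ i, termVars (ts i)

def Atom.vars {L : FirstOrder.Language.{u, v}} {V : Type w}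
    (A : Atom L V) : Set V :=
  ⋃ i, termVars (A.args i)

def Atom.Ground {L : FirstOrder.Language.{u, v}} {V : Type w}
    (A : Atom L V) : Prop :=
  A.vars = ∅

def Atom.subst {L : FirstOrder.Language.{u, v}} {V : Type w}
    (A : Atom L V) (θ : Subst L V) : Atom L V :=
  ⟨A.arity, A.pred, fun i => (A.args i).subst θ⟩

def Literal.atom {L : FirstOrder.Language.{u, v}} {V : Type w}
    : Literal L V → Atom L V
  | .pos A => A
  | .neg A => A

def Literal.vars {L : FirstOrder.Language.{u, v}} {V : Type w}
    (l : Literal L V) : Set V :=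
  l.atom.vars

def Literal.subst {L : FirstOrder.Language.{u, v}} {V : Type w}
    (θ : Subst L V) : Literal L V → Literal L V
  | .pos A => .pos (A.subst θ)
  | .neg A => .neg (A.subst θ)

def Clause.vars {L : FirstOrder.Language.{u, v}} {V : Type w}
    (C : Clause L V) : Set V :=
  C.head.vars ∪ ⋃ l ∈ C.body, l.vars

def Clause.subst {L : FirstOrder.Language.{u, v}} {V : Type w}
    (C : Clause L V) (θ : Subst L V) :
    Clause L V :=
  ⟨C.head.subst θ, C.body.map (Literal.subst θ)⟩

/-- The variant of a clause obtained by renaming its variables along `ρ`. -/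
def Clause.variant {L : FirstOrder.Language.{u, v}} {V : Type w}
    (C : Clause L V) (ρ : Equiv.Perm V) :
    Clause L V :=
  C.subst fun x => .var (ρ x)

/-- `θ` is a most general unifier of the atoms `A` and `B`. -/
def IsMGU {L : FirstOrder.Language.{u, v}} {V : Type w}
    (θ : Subst L V) (A B : Atom L V) : Prop :=
  A.subst θ = B.subst θ ∧
    ∀ τ : Subst L V, A.subst τ = B.subst τ → ∃ σ : Subst L V, ∀ x, τ x = (θ x).subst σ

/-! ### Symbol strings and the relation "loops into" -/

/-- The letters of symbol strings; `X` stands for every variable. -/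
inductive Letter (L : FirstOrder.Language.{u, v}) where
  | pred (p : Σ n, L.Relations n)
  | func (f : Σ n, L.Functions n)
  | X

/-- The symbol string of a term. -/
def termString {L : FirstOrder.Language.{u, v}} {V : Type w}
    : L.Term V → List (Letter L)
  | .var _ => [.X]
  | .func f ts => .func ⟨_, f⟩ :: (List.ofFn fun i => termString (ts i)).flatten

/-- The symbol string of an atom. -/
def Atom.string {L : FirstOrder.Language.{u, v}} {V : Type w}
    (A : Atom L V) : List (Letter L) :=
  .pred ⟨A.arity, A.pred⟩ :: (List.ofFn fun i => termString (A.args i)).flatten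

/-- `A` loops into `B`: both have the same predicate symbol and the symbol string of `A` is
obtained from that of `B` by removing zero or more letters. -/
def LoopsInto {L : FirstOrder.Language.{u, v}} {V : Type w}
    (A B : Atom L V) : Prop :=
  (⟨A.arity, A.pred⟩ : Σ n, L.Relations n) = ⟨B.arity, B.pred⟩ ∧ A.string.Sublist B.string

/-! ### Generalized SLDNF-trees

The nodes of a tree are addressed by the sequence of edges that leads to them from the root, the
most recent edge first. -/

/-- The edges out of a node: application of the `k`-th clause to the selected subgoal; the negation
arc, from a node that selects `¬ A` to the root `← A` of its subsidiary tree; and the edge that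
drops `¬ A` from the goal once this subsidiary tree has finitely failed. -/
inductive Edge {L : FirstOrder.Language.{u, v}} {V : Type w}
    (P : Program L V) where
  | clause (k : Fin P.length)
  | negArc
  | negDrop

abbrev Address {L : FirstOrder.Language.{u, v}} {V : Type w}
    (P : Program L V) := List (Edge P)

/-- A goal in which every subgoal carries its ancestors, given as the list of the nodes at which
they were selected. The selected subgoal is always the first one. -/
abbrev AncGoal {L : FirstOrder.Language.{u, v}} {V : Type w}
    (P : Program L V) :=
  List (Literal L V × List (Address P))

def AncGoal.vars {L : FirstOrder.Language.{u, v}} {V : Type w}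
    {P : Program L V} (G : AncGoal P) : Set V :=
  ⋃ l ∈ G, l.1.vars

/-- `G'` is a resolvent, with some mgu `θ`, of the goal `G` at the node `a` and a variant of the
clause `C` that has no variable in common with `G`. The new subgoals get as ancestors the selected
subgoal of `a` and the ancestors of that subgoal; the other subgoals keep their ancestors. -/
def IsResolvent {L : FirstOrder.Language.{u, v}} {V : Type w}
    {P : Program L V} (a : Address P)
    (G : AncGoal P) (C : Clause L V) (G' : AncGoal P) : Prop :=
  ∃ (A : Atom L V) (anc : List (Address P)) (rest : AncGoal P) (ρ : Equiv.Perm V) (θ : Subst L V),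
    G = (.pos A, anc) :: rest ∧
    Disjoint (C.variant ρ).vars (AncGoal.vars G) ∧
    IsMGU θ A (C.variant ρ).head ∧
    G' = ((C.variant ρ).body.map (fun l => (l.subst θ, a :: anc))) ++
      rest.map (fun l => (l.1.subst θ, l.2))

/-- A set of nodes, labelled by goals (the label of an address outside `nodes` is irrelevant). -/
structure LabelledTree {L : FirstOrder.Language.{u, v}} {V : Type w}
    (P : Program L V) where
  nodes : Set (Address P)
  goal : Address P → AncGoal P

mutual
/-- Below (or at) the node `a` there is a success leaf of the SLDNF-tree to which `a` belongs. -/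
inductive Succeeds {L : FirstOrder.Language.{u, v}} {V : Type w}
    {P : Program L V} (T : LabelledTree P) :
    Address P → Prop
  | leaf (a : Address P) : a ∈ T.nodes → T.goal a = [] → Succeeds T a
  | clause (a : Address P) (k : Fin P.length) : Edge.clause k :: a ∈ T.nodes →
      Succeeds T (Edge.clause k :: a) → Succeeds T a
  | negDrop (a : Address P) : Edge.negDrop :: a ∈ T.nodes →
      FinitelyFails T (Edge.negArc :: a) → Succeeds T (Edge.negDrop :: a) → Succeeds T a
/-- The part below the node `a` of the SLDNF-tree to which `a` belongs is finite and all of its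
leaves are failure leaves. A node that selects a ground `¬ A` is a failure leaf when its subsidiary
tree has a success leaf. -/
inductive FinitelyFails {L : FirstOrder.Language.{u, v}} {V : Type w}
    {P : Program L V} (T : LabelledTree P) :
    Address P → Prop
  | pos (a : Address P) (A : Atom L V) (anc : List (Address P)) (rest : AncGoal P) :
      a ∈ T.nodes → T.goal a = (.pos A, anc) :: rest →
      (∀ k : Fin P.length, Edge.clause k :: a ∈ T.nodes → FinitelyFails T (Edge.clause k :: a)) →
      FinitelyFails T a
  | negArc (a : Address P) : Edge.negArc :: a ∈ T.nodes →
      Succeeds T (Edge.negArc :: a) → FinitelyFails T a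
  | negDrop (a : Address P) : Edge.negDrop :: a ∈ T.nodes →
      FinitelyFails T (Edge.negArc :: a) → FinitelyFails T (Edge.negDrop :: a) → FinitelyFails T a
end

/-- The node `a` belongs to a subsidiary SLDNF-tree in which some success leaf comes before `a` in
the depth-first order: at some node `c` of that subsidiary tree the path to `a` follows the `k`-th
clause, and there is a success leaf below the child of `c` for an earlier clause. -/
def Pruned {L : FirstOrder.Language.{u, v}} {V : Type w}
    {P : Program L V} (T : LabelledTree P)
    (a : Address P) : Prop :=
  ∃ (l c : Address P) (j k : Fin P.length), a = l ++ Edge.clause k :: c ∧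
    Edge.negArc ∉ l ∧ Edge.negArc ∈ c ∧ j < k ∧ Succeeds T (Edge.clause j :: c)

/-- Generalized SLDNF-trees for `P` and the top goal `← G₀`, under the depth-first, left-most
control strategy. They differ in the variants of clauses and the mgus that are used; these are
arbitrary, so every convention on the direction in which an mgu binds two variables (in particular
that of moded generalized SLDNF-trees, whose top goal has input variables that must not be bound to
ordinary variables) gives a tree of this kind. -/
structure GenSLDNFTree {L : FirstOrder.Language.{u, v}} {V : Type w}
    (P : Program L V) (G₀ : Goal L V)
    extends LabelledTree P where
  root_mem : [] ∈ nodes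
  root_goal : goal [] = G₀.map (fun l => (l, []))
  /-- A node that selects an atom has a child for every clause that applies, unless the tree was
  left before the node was expanded. -/
  clause_mem : ∀ a k, Edge.clause k :: a ∈ nodes ↔
    a ∈ nodes ∧ ¬ Pruned toLabelledTree a ∧ ∃ G', IsResolvent a (goal a) (P.get k) G'
  clause_goal : ∀ a k, Edge.clause k :: a ∈ nodes →
    IsResolvent a (goal a) (P.get k) (goal (Edge.clause k :: a))
  /-- A node that selects `¬ A` with `A` ground has a subsidiary tree. -/
  negArc_mem : ∀ a, Edge.negArc :: a ∈ nodes ↔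
    a ∈ nodes ∧ ¬ Pruned toLabelledTree a ∧
      ∃ A anc rest, goal a = (.neg A, anc) :: rest ∧ A.Ground
  /-- The root of the subsidiary tree is `← A`, where `A` inherits the ancestors of `¬ A`. -/
  negArc_goal : ∀ a A anc rest, Edge.negArc :: a ∈ nodes → goal a = (.neg A, anc) :: rest →
    goal (Edge.negArc :: a) = [(.pos A, anc)]
  negDrop_mem : ∀ a, Edge.negDrop :: a ∈ nodes ↔
    Edge.negArc :: a ∈ nodes ∧ FinitelyFails toLabelledTree (Edge.negArc :: a)
  negDrop_goal : ∀ a l rest, Edge.negDrop :: a ∈ nodes → goal a = l :: rest →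
    goal (Edge.negDrop :: a) = rest

/-- A generalized SLDNF-derivation: a finite or infinite path that starts at the root. Only the
values `node i` with `i ≤ length` matter. -/
structure Derivation {L : FirstOrder.Language.{u, v}} {V : Type w}
    {P : Program L V} {G₀ : Goal L V}
    (T : GenSLDNFTree P G₀) where
  /-- The number of edges. -/
  length : ℕ∞
  node : ℕ → Address P
  node_zero : node 0 = []
  step : ∀ i : ℕ, (i : ℕ∞) < length →
    node (i + 1) ∈ T.nodes ∧ ∃ e : Edge P, node (i + 1) = e :: node i

/-- The `i`-th step of the derivation applies the `k`-th clause. -/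
def Derivation.AppliesAt {L : FirstOrder.Language.{u, v}} {V : Type w}
    {P : Program L V} {G₀ : Goal L V}
    {T : GenSLDNFTree P G₀} (D : Derivation T) (i : ℕ) (k : Fin P.length) : Prop :=
  (i : ℕ∞) < D.length ∧ D.node (i + 1) = Edge.clause k :: D.node i

/-- The goal at the node `b` is a loop goal of the goal at the node `a`: both select an atom, the
one selected at `a` is an ancestor of the one selected at `b`, and it loops into the latter. -/
def IsLoopGoal {L : FirstOrder.Language.{u, v}} {V : Type w}
    {P : Program L V} (T : LabelledTree P)
    (a b : Address P) : Prop :=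
  ∃ A ancA restA B ancB restB,
    T.goal a = (.pos A, ancA) :: restA ∧ T.goal b = (.pos B, ancB) :: restB ∧
    a ∈ ancB ∧ LoopsInto A B

/-- A loop check tells at which nodes (given by their index) a derivation in a generalized
SLDNF-tree is cut, that is, loses all later nodes. -/
abbrev LoopCheck (L : FirstOrder.Language.{u, v}) (V : Type w) :=
  ∀ (P : Program L V) (G₀ : Goal L V) (T : GenSLDNFTree P G₀), Derivation T → ℕ → Prop

/-- A loop check is complete if it cuts all infinite derivations in generalized SLDNF-trees. -/
def LoopCheck.IsComplete {L : FirstOrder.Language.{u, v}} {V : Type w}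
    (c : LoopCheck L V) : Prop :=
  ∀ (P : Program L V) (G₀ : Goal L V) (T : GenSLDNFTree P G₀) (D : Derivation T),
    D.length = ⊤ → ∃ n, c P G₀ T D n

/-- LP-check with repetition number `r` cuts a derivation at its node `n = g r` if there are nodes
`g 1 < … < g r`, each a loop goal of the preceding one, to which the same clause is applied. -/
def lpCheck (L : FirstOrder.Language.{u, v}) (V : Type w) (r : ℕ) : LoopCheck L V :=
  fun P _ T D n => ∃ (g : ℕ → ℕ) (k : Fin P.length), g r = n ∧
    (∀ j, 1 ≤ j → j < r →
      g j < g (j + 1) ∧ IsLoopGoal T.toLabelledTree (D.node (g j)) (D.node (g (j + 1)))) ∧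
    ∀ j, 1 ≤ j → j ≤ r → D.AppliesAt (g j) k

end LogicProg

namespace LogicProg

variable {L : FirstOrder.Language.{u, v}} {V : Type w}

/-! ### Symbol strings under substitution -/

-- An infinite derivation contains an infinite chain of resolved atoms, each an ancestor of all
-- later ones (`exists_ancestor_chain`). Otherwise `Descends` would be well-founded and its ordinal
-- ranks would weigh the subgoals. Every step replaces the selected subgoal by finitely many lighter
-- ones, possibly discarding others, so the goals would descend forever in the well-founded
-- Dershowitz–Manna order (`not_wellFounded_descends`).
--
-- The strings of the chain's atoms use only a finite alphabet, the letters of the program and top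
-- goal together with `X`, because an mgu introduces no new function symbol (`IsMGU.termOver`,
-- `atomOver_letters`). Higman's lemma (`exists_sublist_subseq`) yields an infinite subchain in
-- which each string embeds in all later ones, and the pigeonhole principle makes the applied clause
-- constant. Any `r` consecutive members then trigger the check.

/-- All letters of the symbol string of `t` belong to `S`. -/
def TermOver (S : Set (Letter L)) (t : L.Term V) : Prop :=
  ∀ x ∈ termString t, x ∈ S

/-- All letters of the symbol string of `A` belong to `S`. -/
def AtomOver (S : Set (Letter L)) (A : Atom L V) : Prop :=
  ∀ x ∈ A.string, x ∈ S

theorem termOver_var (S : Set (Letter L)) (x : V) :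
    TermOver S (.var x : L.Term V) ↔ .X ∈ S := by
  simp [TermOver, termString]

theorem termOver_func (S : Set (Letter L)) {n : ℕ} (f : L.Functions n) (ts : Fin n → L.Term V) :
    TermOver S (.func f ts) ↔ .func ⟨n, f⟩ ∈ S ∧ ∀ i, TermOver S (ts i) := by
  simp only [TermOver, termString, List.mem_cons, List.mem_flatten, List.mem_ofFn]
  grind

theorem atomOver_iff (S : Set (Letter L)) (A : Atom L V) :
    AtomOver S A ↔ .pred ⟨A.arity, A.pred⟩ ∈ S ∧ ∀ i, TermOver S (A.args i) := by
  simp only [AtomOver, TermOver, Atom.string, List.mem_cons, List.mem_flatten, List.mem_ofFn]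
  grind

theorem TermOver.subst {S : Set (Letter L)} {θ : Subst L V} (hθ : ∀ x, TermOver S (θ x))
    {t : L.Term V} (ht : TermOver S t) : TermOver S (t.subst θ) := by
  induction t with
  | var x => exact hθ x
  | func f ts ih =>
    rw [termOver_func] at ht
    exact (termOver_func ..).2 ⟨ht.1, fun i => ih i (ht.2 i)⟩

/-- A substitution changes only variables, so every function symbol of `t` survives in the instance.
-/
theorem TermOver.of_subst {S : Set (Letter L)} (hX : .X ∈ S) {θ : Subst L V}
    {t : L.Term V} (ht : TermOver S (t.subst θ)) : TermOver S t := by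
  induction t with
  | var x => exact (termOver_var S x).2 hX
  | func f ts ih =>
    have ht := (termOver_func ..).1 ht
    exact (termOver_func ..).2 ⟨ht.1, fun i => ih i (ht.2 i)⟩

theorem AtomOver.subst {S : Set (Letter L)} {θ : Subst L V} (hθ : ∀ x, TermOver S (θ x))
    {A : Atom L V} (hA : AtomOver S A) : AtomOver S (A.subst θ) := by
  rw [atomOver_iff] at hA ⊢
  exact ⟨hA.1, fun i => (hA.2 i).subst hθ⟩

theorem Literal.atom_subst (θ : Subst L V) (l : Literal L V) :
    (l.subst θ).atom = l.atom.subst θ := by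
  cases l <;> rfl

/-! ### Most general unifiers introduce no function symbols -/

open Classical in
/-- Replace by the variable `v₀` every maximal subterm headed by a function symbol outside `S`. -/
noncomputable def collapse (S : Set (Letter L)) (v₀ : V) : L.Term V → L.Term V
  | .var x => .var x
  | .func (l := n) f ts =>
    if .func ⟨n, f⟩ ∈ S then .func f fun i => collapse S v₀ (ts i) else .var v₀

theorem termOver_collapse {S : Set (Letter L)} (hX : .X ∈ S) (v₀ : V) (t : L.Term V) :
    TermOver S (collapse S v₀ t) := by
  induction t with
  | var x => exact (termOver_var S x).2 hX
  | func f ts ih =>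
    rw [collapse]
    split_ifs with h
    · exact (termOver_func ..).2 ⟨h, ih⟩
    · exact (termOver_var S v₀).2 hX

theorem TermOver.collapse_subst {S : Set (Letter L)} (v₀ : V) (θ : Subst L V) {t : L.Term V}
    (ht : TermOver S t) : collapse S v₀ (t.subst θ) = t.subst fun x => collapse S v₀ (θ x) := by
  induction t with
  | var x => rfl
  | func f ts ih =>
    rw [termOver_func] at ht
    simp only [FirstOrder.Language.Term.subst, collapse, if_pos ht.1]
    congr 1
    exact funext fun i => ih i (ht.2 i)

/-- The atom obtained by collapsing all arguments. -/
noncomputable def Atom.collapse (S : Set (Letter L)) (v₀ : V) (A : Atom L V) : Atom L V :=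
  ⟨A.arity, A.pred, fun i => LogicProg.collapse S v₀ (A.args i)⟩

theorem AtomOver.collapse_subst {S : Set (Letter L)} (v₀ : V) (θ : Subst L V) {A : Atom L V}
    (hA : AtomOver S A) :
    (A.subst θ).collapse S v₀ = A.subst fun x => LogicProg.collapse S v₀ (θ x) := by
  rw [atomOver_iff] at hA
  simp only [Atom.collapse, Atom.subst]
  congr 1
  exact funext fun i => (hA.2 i).collapse_subst v₀ θ

/-- Collapsing the values of `θ` gives another unifier, since `A` and `B` contain no collapsed
symbol. By generality each collapsed value is an instance of `θ x`, and an instance keeps all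
function symbols of `θ x`. -/
theorem IsMGU.termOver [Nonempty V] {S : Set (Letter L)} (hX : .X ∈ S) {θ : Subst L V}
    {A B : Atom L V} (h : IsMGU θ A B) (hA : AtomOver S A) (hB : AtomOver S B) (x : V) :
    TermOver S (θ x) := by
  let v₀ : V := Classical.arbitrary V
  obtain ⟨σ, hσ⟩ := h.2 (fun x => LogicProg.collapse S v₀ (θ x)) (by
    rw [← hA.collapse_subst, ← hB.collapse_subst, h.1])
  exact TermOver.of_subst hX (hσ x ▸ termOver_collapse hX v₀ (θ x))

/-! ### The letters of a tree -/

/-- The letters of a program and a top goal, together with the letter for variables. -/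
def letters (P : Program L V) (G₀ : Goal L V) : Set (Letter L) :=
  {x | x = .X ∨ (∃ C ∈ P, x ∈ C.head.string ∨ ∃ l ∈ C.body, x ∈ l.atom.string) ∨
    ∃ l ∈ G₀, x ∈ l.atom.string}

theorem finite_letters (P : Program L V) (G₀ : Goal L V) : (letters P G₀).Finite := by
  have h : letters P G₀ ⊆ {x | x ∈ Letter.X :: (P.flatMap (fun C => C.head.string ++
      C.body.flatMap fun l => l.atom.string) ++ G₀.flatMap fun l => l.atom.string)} := by
    intro x hx
    simpa [letters] using hx
  exact (List.finite_toSet _).subset h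

theorem IsResolvent.atomOver [Nonempty V] {P : Program L V} {S : Set (Letter L)} (hX : .X ∈ S)
    {a : Address P} {G G' : AncGoal P} {C : Clause L V} (h : IsResolvent a G C G')
    (hC : AtomOver S C.head) (hC' : ∀ l ∈ C.body, AtomOver S l.atom)
    (hG : ∀ l ∈ G, AtomOver S l.1.atom) : ∀ l ∈ G', AtomOver S l.1.atom := by
  obtain ⟨A, anc, rest, ρ, θ, rfl, -, hθ, rfl⟩ := h
  have hρ : ∀ x, TermOver S (.var (ρ x) : L.Term V) := fun x => (termOver_var S _).2 hX
  have hθ' := hθ.termOver hX (hG _ (List.mem_cons_self ..)) (hC.subst hρ)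
  intro l hl
  simp only [Clause.variant, Clause.subst, List.mem_append, List.mem_map] at hl
  rcases hl with ⟨_, ⟨l, hl, rfl⟩, rfl⟩ | ⟨l, hl, rfl⟩
  · simp only [Literal.atom_subst]
    exact ((hC' l hl).subst hρ).subst hθ'
  · simp only [Literal.atom_subst]
    exact (hG l (List.mem_cons_of_mem _ hl)).subst hθ'

/-! ### Invariants of the nodes of a tree -/

namespace GenSLDNFTree

variable {P : Program L V} {G₀ : Goal L V} (T : GenSLDNFTree P G₀)

theorem atomOver_letters [Nonempty V] (a : Address P) (ha : a ∈ T.nodes) :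
    ∀ l ∈ T.goal a, AtomOver (letters P G₀) l.1.atom := by
  induction a with
  | nil =>
    intro l hl
    simp only [T.root_goal, List.mem_map] at hl
    obtain ⟨l, hl, rfl⟩ := hl
    exact fun x hx => .inr (.inr ⟨l, hl, hx⟩)
  | cons e a ih =>
    cases e with
    | clause k =>
      have hk := List.get_mem P k
      exact (T.clause_goal a k ha).atomOver (.inl rfl)
        (fun x hx => .inr (.inl ⟨_, hk, .inl hx⟩))
        (fun l hl x hx => .inr (.inl ⟨_, hk, .inr ⟨l, hl, hx⟩⟩))
        (ih ((T.clause_mem a k).1 ha).1)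
    | negArc =>
      obtain ⟨ha', -, A, anc, rest, hG, -⟩ := (T.negArc_mem a).1 ha
      have := ih ha'
      simp only [hG, T.negArc_goal a A anc rest ha hG, List.forall_mem_cons] at this ⊢
      exact ⟨this.1, by simp⟩
    | negDrop =>
      obtain ⟨ha', -, A, anc, rest, hG, -⟩ := (T.negArc_mem a).1 ((T.negDrop_mem a).1 ha).1
      have := ih ha'
      simp only [hG, T.negDrop_goal a _ rest ha hG, List.forall_mem_cons] at this ⊢
      exact this.2

/-- A step adds to ancestor lists at most the node it leaves, whose address is one edge shorter.
This later turns ancestry into an order of indices. -/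
theorem length_lt_of_mem_ancestors (a : Address P) (ha : a ∈ T.nodes) :
    ∀ l ∈ T.goal a, ∀ b ∈ l.2, b.length < a.length := by
  induction a with
  | nil =>
    intro l hl
    simp only [T.root_goal, List.mem_map] at hl
    obtain ⟨l, hl, rfl⟩ := hl
    simp
  | cons e a ih =>
    cases e with
    | clause k =>
      obtain ⟨A, anc, rest, ρ, θ, hG, -, -, hG'⟩ := T.clause_goal a k ha
      have := ih ((T.clause_mem a k).1 ha).1
      intro l hl b hb
      rw [List.length_cons]
      simp only [hG', List.mem_append, List.mem_map] at hl
      rcases hl with ⟨l, hl, rfl⟩ | ⟨l, hl, rfl⟩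
      · rcases List.mem_cons.1 hb with rfl | hb
        · exact Nat.lt_succ_self _
        · exact (this _ (hG ▸ List.mem_cons_self ..) b hb).trans (Nat.lt_succ_self _)
      · exact (this l (hG ▸ List.mem_cons_of_mem _ hl) b hb).trans (Nat.lt_succ_self _)
    | negArc =>
      obtain ⟨ha', -, A, anc, rest, hG, -⟩ := (T.negArc_mem a).1 ha
      have := ih ha'
      simp only [hG, T.negArc_goal a A anc rest ha hG, List.forall_mem_cons] at this ⊢
      exact ⟨fun b hb => (this.1 b hb).trans (Nat.lt_succ_self _), by simp⟩
    | negDrop =>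
      obtain ⟨ha', -, A, anc, rest, hG, -⟩ := (T.negArc_mem a).1 ((T.negDrop_mem a).1 ha).1
      have := ih ha'
      simp only [hG, T.negDrop_goal a _ rest ha hG, List.forall_mem_cons] at this ⊢
      exact fun l hl b hb => (this.2 l hl b hb).trans (Nat.lt_succ_self _)

end GenSLDNFTree

/-! ### Infinite derivations have infinite chains of ancestors -/

namespace Derivation

variable {P : Program L V} {G₀ : Goal L V} {T : GenSLDNFTree P G₀} (D : Derivation T)

theorem node_mem {i : ℕ} (hi : (i : ℕ∞) ≤ D.length) : D.node i ∈ T.nodes := by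
  cases i with
  | zero => exact D.node_zero ▸ T.root_mem
  | succ i => exact (D.step i (lt_of_lt_of_le (by exact_mod_cast Nat.lt_succ_self i) hi)).1

theorem length_node {i : ℕ} (hi : (i : ℕ∞) ≤ D.length) : (D.node i).length = i := by
  induction i with
  | zero => simp [D.node_zero]
  | succ i ih =>
    have hlt : (i : ℕ∞) < D.length := lt_of_lt_of_le (by exact_mod_cast Nat.lt_succ_self i) hi
    obtain ⟨-, e, he⟩ := D.step i hlt
    rw [he, List.length_cons, ih hlt.le]

/-- The derivation applies a clause at its `i`-th node to an atom with ancestors `anc`. -/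
def ResolvesAt (i : ℕ) (anc : List (Address P)) : Prop :=
  ∃ k A rest, D.AppliesAt i k ∧ T.goal (D.node i) = (.pos A, anc) :: rest

/-- `anc'` is the list of ancestors of the subgoals that replace, in the course of the derivation,
an atom whose ancestors are `anc`. -/
def Descends (anc' anc : List (Address P)) : Prop :=
  ∃ i, D.ResolvesAt i anc ∧ anc' = D.node i :: anc

/-- The weight of a subgoal with respect to a ranking of the lists of ancestors. -/
def weight (rk : List (Address P) → Ordinal.{0}) :
    Literal L V × List (Address P) → Ordinal.{0} ×ₗ ℕ
  -- A negation arc preserves the ancestor list; the second component makes it decrease the weight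
  -- all the same.
  | (.pos _, anc) => toLex (rk anc, 0)
  | (.neg _, anc) => toLex (rk anc, 1)

theorem weight_lt_weight {rk : List (Address P) → Ordinal.{0}} {anc anc' : List (Address P)}
    (h : rk anc' < rk anc) (l l' : Literal L V) : weight rk (l', anc') < weight rk (l, anc) := by
  cases l <;> cases l' <;> exact Prod.Lex.toLex_lt_toLex.2 (.inl h)

theorem weight_subst (rk : List (Address P) → Ordinal.{0}) (θ : Subst L V) (l : Literal L V)
    (anc : List (Address P)) : weight rk (l.subst θ, anc) = weight rk (l, anc) := by
  cases l <;> rfl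

theorem not_wellFounded_descends (hD : D.length = ⊤) : ¬ WellFounded D.Descends := by
  intro hwf
  have : IsWellFounded _ D.Descends := ⟨hwf⟩
  let rk : List (Address P) → Ordinal.{0} := IsWellFounded.rank D.Descends
  let M : ℕ → Multiset (Ordinal.{0} ×ₗ ℕ) :=
    fun i => ((T.goal (D.node i)).map (weight rk) : List _)
  have hM : ∀ i, (M (i + 1)).IsDershowitzMannaLT (M i) := by
    intro i
    have hi : (i : ℕ∞) < D.length := hD ▸ WithTop.coe_lt_top i
    obtain ⟨hmem, e, he⟩ := D.step i hi
    simp only [M]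
    cases e with
    | clause k =>
      obtain ⟨A, anc, rest, ρ, θ, hG, -, -, hG'⟩ := T.clause_goal _ k (he ▸ hmem)
      have hlt : rk (D.node i :: anc) < rk anc :=
        IsWellFounded.rank_lt_of_rel ⟨i, ⟨k, A, rest, ⟨hi, he⟩, hG⟩, rfl⟩
      -- In order: the weights kept, those added by the clause body, and the one removed.
      refine ⟨(rest.map (weight rk) : List _), ((((P.get k).variant ρ).body.map
        (fun l => (l.subst θ, D.node i :: anc))).map (weight rk) : List _),
        {weight rk (.pos A, anc)}, by simp, ?_, ?_, ?_⟩
      · rw [he, hG', List.map_append, add_comm, ← Multiset.coe_add]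
        congr 2
        simp [Function.comp_def, weight_subst]
      · rw [hG, add_comm]; rfl
      · intro y hy
        simp only [Multiset.mem_coe, List.mem_map] at hy
        obtain ⟨_, ⟨l, -, rfl⟩, rfl⟩ := hy
        exact ⟨_, Multiset.mem_singleton_self _, weight_lt_weight hlt _ _⟩
    | negArc =>
      rw [he] at hmem
      obtain ⟨-, -, A, anc, rest, hG, -⟩ := (T.negArc_mem _).1 hmem
      rw [he, T.negArc_goal _ A anc rest hmem hG, hG]
      -- The arc also discards the rest of the goal, so nothing is kept.
      refine ⟨0, _, _, ?_, (zero_add _).symm, (zero_add _).symm, ?_⟩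
      · simp
      · intro y hy
        obtain rfl : y = weight rk (.pos A, anc) := by simpa using hy
        exact ⟨weight rk (.neg A, anc), by simp,
          Prod.Lex.toLex_lt_toLex.2 (.inr ⟨rfl, Nat.zero_lt_one⟩)⟩
    | negDrop =>
      rw [he] at hmem
      obtain ⟨-, -, A, anc, rest, hG, -⟩ := (T.negArc_mem _).1 ((T.negDrop_mem _).1 hmem).1
      rw [he, T.negDrop_goal _ _ rest hmem hG, hG]
      exact ⟨(rest.map (weight rk) : List _), 0, {weight rk (.neg A, anc)}, by simp,
        (add_zero _).symm, by rw [add_comm]; rfl, by simp⟩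
  exact (wellFounded_iff_isEmpty_descending_chain.1
    Multiset.wellFounded_isDershowitzMannaLT).false ⟨M, hM⟩

/-- An infinite derivation resolves infinitely many atoms each of which is an ancestor of all the
later ones. -/
theorem exists_ancestor_chain (hD : D.length = ⊤) :
    ∃ (i : ℕ → ℕ) (k : ℕ → Fin P.length) (A : ℕ → Atom L V) (anc : ℕ → List (Address P))
      (rest : ℕ → AncGoal P), StrictMono i ∧ (∀ n, D.AppliesAt (i n) (k n)) ∧
      (∀ n, T.goal (D.node (i n)) = (.pos (A n), anc n) :: rest n) ∧
      ∀ m n, m < n → D.node (i m) ∈ anc n := by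
  have h := D.not_wellFounded_descends hD
  rw [wellFounded_iff_isEmpty_descending_chain, not_isEmpty_iff] at h
  obtain ⟨anc, hanc⟩ := h
  choose i hi hcons using hanc
  choose k A rest hk hG using hi
  -- Each list of the descending chain extends its predecessor by one node, so nodes once added
  -- persist.
  have hmem : ∀ m n, m < n → D.node (i m) ∈ anc n := by
    intro m n hmn
    induction n, hmn using Nat.le_induction with
    | base => simp [hcons m]
    | succ n _ ih => rw [hcons n]; exact List.mem_cons_of_mem _ ih
  refine ⟨i, k, A, anc, rest, strictMono_nat_of_lt_succ fun n => ?_, hk, hG, hmem⟩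
  have hle : ∀ j : ℕ, (j : ℕ∞) ≤ D.length := fun j => hD ▸ le_top
  have := T.length_lt_of_mem_ancestors _ (D.node_mem (hle (i (n + 1)))) _
    (hG (n + 1) ▸ List.mem_cons_self ..) _ (hmem n (n + 1) (Nat.lt_succ_self n))
  rwa [D.length_node (hle _), D.length_node (hle _)] at this

/-- The predicate symbol of a resolved atom is that of the head of the applied clause. -/
theorem AppliesAt.pred_eq {D : Derivation T} {i : ℕ} {k : Fin P.length} (h : D.AppliesAt i k)
    {A : Atom L V} {anc : List (Address P)} {rest : AncGoal P}
    (hG : T.goal (D.node i) = (.pos A, anc) :: rest) :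
    (⟨A.arity, A.pred⟩ : Σ n, L.Relations n) = ⟨(P.get k).head.arity, (P.get k).head.pred⟩ := by
  have hmem := (D.step i h.1).1
  rw [h.2] at hmem
  obtain ⟨A', anc', rest', ρ, θ, hG', -, hθ, -⟩ := T.clause_goal _ k hmem
  rw [hG] at hG'
  cases hG'
  have := congrArg (fun B : Atom L V => (⟨B.arity, B.pred⟩ : Σ n, L.Relations n)) hθ.1
  exact this

end Derivation

-- Higman's lemma and the pigeonhole principle

/-- Among infinitely many words over a finite alphabet there is an infinite subsequence in which
each word is a sublist of all the later ones. -/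
theorem exists_sublist_subseq {α : Type*} {S : Set α} (hS : S.Finite) (s : ℕ → List α)
    (hs : ∀ n, ∀ x ∈ s n, x ∈ S) :
    ∃ g : ℕ ↪o ℕ, ∀ m n, m ≤ n → (s (g m)).Sublist (s (g n)) := by
  have hpwo : S.PartiallyWellOrderedOn (· = ·) := hS.partiallyWellOrderedOn
  have : IsPreorder (List α) (List.SublistForall₂ (· = ·)) := {}
  -- Higman's lemma, for equality on the finite alphabet.
  obtain ⟨g, hg⟩ :=
    (Set.PartiallyWellOrderedOn.partiallyWellOrderedOn_sublistForall₂ (· = ·)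
      hpwo).exists_monotone_subseq (f := s) hs
  refine ⟨g, fun m n hmn => ?_⟩
  obtain ⟨l, hl, hsub⟩ := List.sublistForall₂_iff.1 (hg m n hmn)
  rw [List.forall₂_eq_eq_eq] at hl
  exact hl ▸ hsub

theorem exists_constant_subseq {α : Type*} [Finite α] (f : ℕ → α) :
    ∃ (g : ℕ ↪o ℕ) (a : α), ∀ n, f (g n) = a := by
  classical
  obtain ⟨a, ha⟩ := Finite.exists_infinite_fiber f
  exact ⟨Nat.orderEmbeddingOfSet (f ⁻¹' {a}), a,
    fun n => (Nat.Subtype.orderIsoOfNat (f ⁻¹' {a}) n).2⟩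

end LogicProg

open LogicProg in
theorem mainTheorem4 {L : FirstOrder.Language.{u, v}} {V : Type w} [Infinite V] (r : ℕ)
    (hr : 2 ≤ r) : (LogicProg.lpCheck L V r).IsComplete := by
  intro P G₀ T D hD
  obtain ⟨i, k, A, anc, rest, hi, hk, hG, hmem⟩ := D.exists_ancestor_chain hD
  obtain ⟨g, hg⟩ := exists_sublist_subseq (finite_letters P G₀) (fun n => (A n).string)
    fun n => T.atomOver_letters _ (D.node_mem (hD ▸ le_top)) (.pos (A n), anc n) (hG n ▸ List.mem_cons_self ..)
  obtain ⟨h, c, hc⟩ := exists_constant_subseq fun n => k (g n)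
  have hmono : StrictMono fun n => g (h n) := g.strictMono.comp h.strictMono
  have hc' : ∀ n, D.AppliesAt (i (g (h n))) c := fun n => hc n ▸ hk (g (h n))
  refine ⟨_, fun n => i (g (h n)), c, rfl, fun j _ _ => ?_, fun j _ _ => hc' j⟩
  have hlt := Nat.lt_succ_self j
  -- The predicate symbols agree because both atoms unify with variants of the head of the same
  -- clause.
  exact ⟨hi (hmono hlt), A _, anc _, rest _, A _, anc _, rest _, hG _, hG _,
    hmem _ _ (hmono hlt), ((hc' j).pred_eq (hG _)).trans ((hc' (j + 1)).pred_eq (hG _)).symm,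
    hg _ _ (h.monotone hlt.le)⟩
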